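/- All quantum systems are finite-dimensional. A state is a positive semi-definite operator of unit trace, and a channel is a completely positive trace-preserving linear map. Fix an integer $k\ge 2$. A state $\rho_{AB}$ is $k$-extendible, written $\rho_{AB}\in\mathrm{EXT}_k(A;B)$, if there is a state $\omega_{AB_1\cdots B_k}$ (each $B_i\simeq B$) that is invariant under all permutations of $B_1,\dots,B_k$ and satisfies $\operatorname{Tr}_{B_2\cdots B_k}\omega_{AB_1\cdots B_k}=\rho_{AB}$. A bipartite channel $\mathcal N_{AB\to A'B'}$ is $k$-extendible if there is a channel $\mathcal M_{AB_1\cdots B_k\to A'B_1'\cdots B_k'}$ such that, for every state $\theta_{AB_1\cdots B_k}$, (i) $\mathcal M(\mathcal W^\pi_{B_1\cdots B_k}(\theta))=\mathcal W^\pi_{B'_1\cdots B'_k}(\mathcal M(\theta))$ for all $\pi\in S_k$, where $\mathcal W^\pi$ is conjugation by the unitary permuting the tensor factors, and (ii) $\mathcal N(\theta_{AB_1})=\operatorname{Tr}_{B_2'\cdots B_k'}\mathcal M(\theta)$. Let $D_{\max}(\rho\Vert\sigma)=\inf\{\lambda\in\mathbb R:\rho\le 2^\lambda\sigma\}$ ($+\infty$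 if there is no such $\lambda$), and for a channel $\mathcal N_{A\to B}$ let $$E^{\max}_k(\mathcal N)=\sup_{\psi_{RA}}\ \inf_{\sigma_{RB}\in\mathrm{EXT}_k(R;B)}D_{\max}\big((\mathrm{id}_R\otimes\mathcal N)(\psi_{RA})\,\Vert\,\sigma_{RB}\big),$$ where the supremum is over pure states $\psi_{RA}$ with $|R|=|A|$. Let $n,M\ge 1$ be integers and $\varepsilon\in[0,1]$. An $(n,M,\varepsilon)$ quantum communication protocol over $\mathcal N_{A\to B}$ assisted by $k$-extendible channels consists of $k$-extendible channels $\mathcal K^{(1)}_{\emptyset\to (A_1'A_1):B_1'}$, $\mathcal K^{(i)}_{A_{i-1}':(B_{i-1}B_{i-1}')\to (A_i'A_i):B_i'}$ for $2\le i\le n$, and $\mathcal K^{(n+1)}_{A_n':(B_nB_n')\to M_A:M_B}$, where the left of the colon is Alice's and the right is Bob's (extended) system, $A_i\simeq A$, $B_i\simeq B$, $A_i',B_i'$ are arbitrary finite-dimensional systems, and $|M_A|=|M_B|=M$. Put $\rho^{(1)}=\mathcal K^{(1)}(1)$, $\sigma^{(i)}=\mathcal N_{A_i\to B_i}(\rho^{(i)})$,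 $\rho^{(i)}=\mathcal K^{(i)}(\sigma^{(i-1)})$ for $2\le i\le n$, and $\omega_{M_AM_B}=\mathcal K^{(n+1)}(\sigma^{(n)})$. It is required that $F(\omega_{M_AM_B},\Phi_{M_AM_B})\ge 1-\varepsilon$, where $F(\omega,\tau)=\Vert\sqrt\omega\sqrt\tau\Vert_1^2$ and $\Phi_{M_AM_B}=\frac1M\sum_{m,m'}|m\rangle\langle m'|\otimes|m\rangle\langle m'|$. Theorem. For every integer $k\ge2$, every channel $\mathcal N_{A\to B}$, and every $(n,M,\varepsilon)$ quantum communication protocol over $\mathcal N$ assisted by $k$-extendible channels, $$-\log_2\!\left[\frac1M+\frac1k-\frac1{Mk}\right]\le n\,E^{\max}_k(\mathcal N)+\log_2\!\left(\frac1{1-\varepsilon}\right),$$ where the last term is read as $+\infty$ when $\varepsilon=1$. -/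

import Mathlib

/-!
Finite-dimensional quantum systems are finite index types (labelling an orthonormal basis of the
Hilbert space), operators are complex matrices, and a composite system is a product type.
-/

namespace KUnext

open scoped MatrixOrder ComplexOrder
open Matrix

noncomputable section

/-- Density operators: positive semi-definite with unit trace. -/
def IsState {a : Type*} [Fintype a] (ρ : Matrix a a ℂ) : Prop :=
  ρ.PosSemidef ∧ ρ.trace = 1

/-- The map `id_R ⊗ Φ`, applied to an operator on the composite system `R A`. -/
def idTensor {r a b : Type*} (Φ : Matrix a a ℂ →ₗ[ℂ] Matrix b b ℂ)
    (X : Matrix (r × a) (r × a) ℂ) : Matrix (r × b) (r × b) ℂ :=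
  Matrix.of fun p q => Φ (Matrix.of fun i j => X (p.1, i) (q.1, j)) p.2 q.2

/-- Quantum channels: completely positive, trace-preserving linear maps. -/
structure IsChannel {a b : Type*} [Fintype a] [Fintype b]
    (Φ : Matrix a a ℂ →ₗ[ℂ] Matrix b b ℂ) : Prop where
  completelyPositive : ∀ (r : ℕ) (X : Matrix (Fin r × a) (Fin r × a) ℂ),
    X.PosSemidef → (idTensor Φ X).PosSemidef
  tracePreserving : ∀ X : Matrix a a ℂ, (Φ X).trace = X.trace

/-- The permutation channel `𝒲^π` acting on the systems `B₁ ⋯ B_k` of `A B₁ ⋯ B_k`, that is,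
conjugation by the unitary which permutes the tensor factors. -/
def permuteB {a b : Type*} {k : ℕ} (π : Equiv.Perm (Fin k))
    (ω : Matrix (a × (Fin k → b)) (a × (Fin k → b)) ℂ) :
    Matrix (a × (Fin k → b)) (a × (Fin k → b)) ℂ :=
  Matrix.of fun p q => ω (p.1, p.2 ∘ π) (q.1, q.2 ∘ π)

/-- The partial trace over `B₂ ⋯ B_k`, leaving an operator on `A B₁` (the system `B₁` has
index `0`). The sum runs over all basis labels `f` of `B₁ ⋯ B_k` whose first entry is the
prescribed row label; the column label agrees with `f` on `B₂ ⋯ B_k`. -/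
def traceOutRest {a b : Type*} [Fintype b] [DecidableEq b] {k : ℕ} [NeZero k]
    (ω : Matrix (a × (Fin k → b)) (a × (Fin k → b)) ℂ) : Matrix (a × b) (a × b) ℂ :=
  Matrix.of fun p q =>
    ∑ f : Fin k → b with f 0 = p.2, ω (p.1, f) (q.1, Function.update f 0 q.2)

/-- `ρ ∈ EXT_k(A;B)`: the state `ρ` of `A B` is `k`-extendible with respect to `B`. -/
def IsExtendibleState {a b : Type*} [Fintype a] [Fintype b] [DecidableEq b]
    (k : ℕ) [NeZero k] (ρ : Matrix (a × b) (a × b) ℂ) : Prop :=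
  IsState ρ ∧ ∃ ω : Matrix (a × (Fin k → b)) (a × (Fin k → b)) ℂ,
    IsState ω ∧ (∀ π : Equiv.Perm (Fin k), permuteB π ω = ω) ∧ traceOutRest ω = ρ

/-- `𝒩_{AB → A'B'}` is a `k`-extendible channel: there is a channel
`ℳ_{A B₁ ⋯ B_k → A' B₁' ⋯ B_k'}` which is covariant with respect to permutations of the `B`
systems and has `𝒩` as its marginal. -/
def IsExtendibleChannel {a b a' b' : Type*} [Fintype a] [Fintype b] [Fintype a'] [Fintype b']
    [DecidableEq b] [DecidableEq b'] (k : ℕ) [NeZero k]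
    (N : Matrix (a × b) (a × b) ℂ →ₗ[ℂ] Matrix (a' × b') (a' × b') ℂ) : Prop :=
  IsChannel N ∧
  ∃ M : Matrix (a × (Fin k → b)) (a × (Fin k → b)) ℂ →ₗ[ℂ]
      Matrix (a' × (Fin k → b')) (a' × (Fin k → b')) ℂ,
    IsChannel M ∧
    (∀ (π : Equiv.Perm (Fin k)) (θ : Matrix (a × (Fin k → b)) (a × (Fin k → b)) ℂ),
      IsState θ → M (permuteB π θ) = permuteB π (M θ)) ∧
    (∀ θ : Matrix (a × (Fin k → b)) (a × (Fin k → b)) ℂ,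
      IsState θ → N (traceOutRest θ) = traceOutRest (M θ))

/-- The max-relative entropy `D_max(ρ‖σ) = inf {λ : ρ ≤ 2^λ σ}`, equal to `+∞` if there is no
such real `λ`. -/
def dMax {a : Type*} (ρ σ : Matrix a a ℂ) : EReal :=
  ⨅ (l : ℝ) (_ : (((2 : ℝ) ^ l) • σ - ρ).PosSemidef), (l : EReal)

/-- The max-relative entropy of `k`-unextendibility of a bipartite state,
`E^max_k(A;B)_ρ = inf_{σ ∈ EXT_k(A;B)} D_max(ρ‖σ)`. -/
def eMaxState {a b : Type*} [Fintype a] [Fintype b] [DecidableEq b] (k : ℕ) [NeZero k]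
    (ρ : Matrix (a × b) (a × b) ℂ) : EReal :=
  ⨅ (σ : Matrix (a × b) (a × b) ℂ) (_ : IsExtendibleState k σ), dMax ρ σ

/-- The max-relative entropy of `k`-unextendibility of a channel,
`E^max_k(𝒩) = sup_{ψ_{RA}} E^max_k(R;B)_{𝒩(ψ)}`, over pure states `ψ_{RA}` (unit vectors) with
`R` isomorphic to `A`. -/
def eMaxChannel {a b : Type*} [Fintype a] [Fintype b] [DecidableEq b] (k : ℕ) [NeZero k]
    (N : Matrix a a ℂ →ₗ[ℂ] Matrix b b ℂ) : EReal :=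
  ⨆ (ψ : a × a → ℂ) (_ : ∑ x, ‖ψ x‖ ^ 2 = 1),
    eMaxState k (idTensor N (vecMulVec ψ (star ψ)))

/-- The trace norm `‖X‖₁ = Tr √(X† X)`. -/
def traceNorm {a : Type*} [Fintype a] [DecidableEq a] (X : Matrix a a ℂ) : ℝ :=
  (CFC.sqrt (Xᴴ * X)).trace.re

/-- The fidelity `F(ω,τ) = ‖√ω √τ‖₁²`. -/
def fidelity {a : Type*} [Fintype a] [DecidableEq a] (ω τ : Matrix a a ℂ) : ℝ :=
  traceNorm (CFC.sqrt ω * CFC.sqrt τ) ^ 2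

/-- The maximally entangled state
`Φ = (1/M) ∑_{m,m'} |m⟩⟨m'| ⊗ |m⟩⟨m'|` of Schmidt rank `M`. -/
def maxEntangled (M : ℕ) : Matrix (Fin M × Fin M) (Fin M × Fin M) ℂ :=
  Matrix.of fun p q => if p.1 = p.2 ∧ q.1 = q.2 then 1 / (M : ℂ) else 0

/-- One use of `𝒩_{A → B}` on a state of `(A' A) : B'`: Alice's system `A` is sent through `𝒩`
and its output `B` joins Bob's laboratory, which gives a state of `A' : (B B')`. -/
def useChannel {a b a' b' : Type*} (N : Matrix a a ℂ →ₗ[ℂ] Matrix b b ℂ)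
    (ρ : Matrix ((a' × a) × b') ((a' × a) × b') ℂ) :
    Matrix (a' × (b × b')) (a' × (b × b')) ℂ :=
  Matrix.of fun p q =>
    N (Matrix.of fun i j => ρ ((p.1, i), p.2.2) ((q.1, j), q.2.2)) p.2.1 q.2.1

/-- The part of a `k`-extendible assisted protocol up to the `n`-th channel use (`n ≥ 1`), where
`dA` and `dB` are the dimensions of the memory systems `A'_n` and `B'_n`.
It consists of the `k`-extendible channel `∅ → (A'₁ A₁) : B'₁` and, for `2 ≤ i ≤ n`, of a
`k`-extendible channel `A'_{i-1} : (B_{i-1} B'_{i-1}) → (A'_i A_i) : B'_i`. -/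
inductive ProtocolPrefix (k : ℕ) [NeZero k] (a b : Type*) [Fintype a] [DecidableEq a]
    [Fintype b] [DecidableEq b] : (n dA dB : ℕ) → Type _
  | init {dA dB : ℕ}
      (K : Matrix (Unit × Unit) (Unit × Unit) ℂ →ₗ[ℂ]
        Matrix ((Fin dA × a) × Fin dB) ((Fin dA × a) × Fin dB) ℂ)
      (hK : IsExtendibleChannel k K) : ProtocolPrefix k a b 1 dA dB
  | step {n dA dB dA' dB' : ℕ} (P : ProtocolPrefix k a b n dA dB)
      (K : Matrix (Fin dA × (b × Fin dB)) (Fin dA × (b × Fin dB)) ℂ →ₗ[ℂ]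
        Matrix ((Fin dA' × a) × Fin dB') ((Fin dA' × a) × Fin dB') ℂ)
      (hK : IsExtendibleChannel k K) : ProtocolPrefix k a b (n + 1) dA' dB'

/-- The state `ρ^{(n)}` of `(A'_n A_n) : B'_n` right before the `n`-th use of `𝒩`. The initial
channel acts on the unique state `1` of the trivial system. -/
def ProtocolPrefix.stateBefore {k : ℕ} [NeZero k] {a b : Type*} [Fintype a] [DecidableEq a]
    [Fintype b] [DecidableEq b] (N : Matrix a a ℂ →ₗ[ℂ] Matrix b b ℂ) :
    {n dA dB : ℕ} → ProtocolPrefix k a b n dA dB →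
      Matrix ((Fin dA × a) × Fin dB) ((Fin dA × a) × Fin dB) ℂ
  | _, _, _, .init K _ => K 1
  | _, _, _, .step P K _ => K (useChannel N (P.stateBefore N))

/-- A `k`-extendible assisted quantum communication protocol with `n` uses of a channel from `a`
to `b`: the steps up to the `n`-th use, followed by a `k`-extendible channel
`A'_n : (B_n B'_n) → M_A : M_B` with `|M_A| = |M_B| = M`. -/
structure AssistedProtocol (k : ℕ) [NeZero k] (n M : ℕ) (a b : Type*) [Fintype a]
    [DecidableEq a] [Fintype b] [DecidableEq b] where
  /-- dimension of Alice's last memory system -/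
  dA : ℕ
  /-- dimension of Bob's last memory system -/
  dB : ℕ
  /-- everything that happens before the last channel use -/
  pre : ProtocolPrefix k a b n dA dB
  /-- the last assisting channel -/
  final : Matrix (Fin dA × (b × Fin dB)) (Fin dA × (b × Fin dB)) ℂ →ₗ[ℂ]
    Matrix (Fin M × Fin M) (Fin M × Fin M) ℂ
  final_extendible : IsExtendibleChannel k final

/-- The final state `ω` of `M_A M_B`, when the protocol is run with the channel `𝒩`. -/
def AssistedProtocol.finalState {k : ℕ} [NeZero k] {n M : ℕ} {a b : Type*} [Fintype a]
    [DecidableEq a] [Fintype b] [DecidableEq b] (P : AssistedProtocol k n M a b)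
    (N : Matrix a a ℂ →ₗ[ℂ] Matrix b b ℂ) : Matrix (Fin M × Fin M) (Fin M × Fin M) ℂ :=
  P.final (useChannel N (P.pre.stateBefore N))

/-- The performance criterion `F(ω, Φ) ≥ 1 - ε` of an `(n, M, ε)` protocol. -/
def AssistedProtocol.Achieves {k : ℕ} [NeZero k] {n M : ℕ} {a b : Type*} [Fintype a]
    [DecidableEq a] [Fintype b] [DecidableEq b] (P : AssistedProtocol k n M a b)
    (N : Matrix a a ℂ →ₗ[ℂ] Matrix b b ℂ) (ε : ℝ) : Prop :=
  1 - ε ≤ fidelity (P.finalState N) (maxEntangled M)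

/-- `log₂(1/x)` for `x ≥ 0`, with the convention `log₂(1/0) = +∞`. -/
def log2Inv (x : ℝ) : EReal :=
  if 0 < x then ((Real.logb 2 (1 / x) : ℝ) : EReal) else ⊤

end

end KUnext

/-! Call ρ c-dominated if ρ ≤ c σ for some k-extendible σ (`IsDominated`). The constant starts at 1,
and k-extendible channels do not increase it. For any real l above the unextendibility of N, one use
of N multiplies it by at most 2^l. Pairing the final domination with Φ gives 1 - ε ≤ 2^(n l) · max
⟨Φ, σ⟩ over k-extendible σ; taking logarithms and letting l decrease to the unextendibility proves
the bound.

The amortization (`IsDominated.amortized`) is a simulation argument. Let ω be a full-rank invariant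
extension of the dominating state and w = G Gᴴ its marginal on A. Then ω arises from the
purification ψ of w by a channel acting on the reference R, with Choi operator P = G⁻¹ ω (G⁻¹)ᴴ.
That channel does not touch A, so it commutes with N. Applying it to an extension of a state
dominating N(ψ) pairs each B_i with its Y_i and yields an invariant extension again.

The overlap bound is spectral. The unnormalized entangled projections Q_i on A B_i satisfy Q_i² = M
Q_i and Q_i Q_j Q_i = Q_i, which forces ∑ Q_i ≤ M + k - 1. In an invariant state all Q_i have the
same expectation, so each is at most (M + k - 1)/k. -/

namespace KUnext

open scoped MatrixOrder ComplexOrder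
open Matrix

noncomputable section

/-! ### Link products and complete positivity -/

variable {a b r x y z : Type*} {k : ℕ}

/-- Summing a positive semi-definite block matrix over all of its blocks preserves positivity. -/
theorem posSemidef_sum_blocks [Fintype x] [Fintype r] {Q : Matrix (x × r) (x × r) ℂ}
    (hQ : Q.PosSemidef) :
    (Matrix.of fun p q => ∑ i, ∑ j, Q (p, i) (q, j) : Matrix x x ℂ).PosSemidef := by
  classical
  have h := hQ.conjTranspose_mul_mul_same (Matrix.of fun (u : x × r) (p : x) =>
    if u.1 = p then (1 : ℂ) else 0)
  convert h using 1
  ext p q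
  simp only [Matrix.of_apply, Matrix.mul_apply, conjTranspose_apply, Fintype.sum_prod_type_right,
    apply_ite (star : ℂ → ℂ), star_one, star_zero, ite_mul, mul_ite, one_mul, mul_one, zero_mul,
    mul_zero, Finset.sum_ite_eq',
    Finset.mem_univ, if_true]
  rw [Finset.sum_comm]

/-- The link product of an operator on `X R Y` with an operator on `R Z`. -/
def linkProd [Fintype r] (P : Matrix ((x × r) × y) ((x × r) × y) ℂ)
    (X : Matrix (r × z) (r × z) ℂ) : Matrix (x × (z × y)) (x × (z × y)) ℂ :=
  Matrix.of fun p q => ∑ i, ∑ j, P ((p.1, i), p.2.2) ((q.1, j), q.2.2) * X (i, p.2.1) (j, q.2.1)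

/-- Reading `P` as the Choi operator of a map out of R, the link product applies that map to the R
part of `X`. It is P ⊗ X compressed to equal labels on the two copies of R, then summed over blocks.
-/
theorem linkProd_posSemidef [Fintype r] [Fintype x] [Fintype y] [Fintype z]
    {P : Matrix ((x × r) × y) ((x × r) × y) ℂ} {X : Matrix (r × z) (r × z) ℂ}
    (hP : P.PosSemidef) (hX : X.PosSemidef) : (linkProd P X).PosSemidef := by
  classical
  have h := posSemidef_sum_blocks ((hP.kronecker hX).submatrix
    fun u : (x × (z × y)) × r => (((u.1.1, u.2), u.1.2.2), (u.2, u.1.2.1)))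
  convert h using 1
  ext p q
  simp [linkProd]

theorem linkProd_sub [Fintype r] (P : Matrix ((x × r) × y) ((x × r) × y) ℂ)
    (X Y : Matrix (r × z) (r × z) ℂ) : linkProd P (X - Y) = linkProd P X - linkProd P Y := by
  ext p q
  simp [linkProd, mul_sub, Finset.sum_sub_distrib]

theorem linkProd_smul [Fintype r] (P : Matrix ((x × r) × y) ((x × r) × y) ℂ)
    (c : ℝ) (X : Matrix (r × z) (r × z) ℂ) : linkProd P (c • X) = c • linkProd P X := by
  ext p q
  simp only [linkProd, Matrix.of_apply, Matrix.smul_apply, mul_smul_comm, Finset.smul_sum]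

/-- Complete positivity is only postulated for references `Fin r`; relabelling reaches every finite
reference. -/
theorem idTensor_posSemidef [Fintype a] [Fintype b] [Fintype r]
    {N : Matrix a a ℂ →ₗ[ℂ] Matrix b b ℂ} (hN : IsChannel N)
    {X : Matrix (r × a) (r × a) ℂ} (hX : X.PosSemidef) : (idTensor N X).PosSemidef := by
  let e := Fintype.equivFin r
  have h := (hN.completelyPositive _ _ (hX.submatrix fun p : Fin (Fintype.card r) × a =>
    (e.symm p.1, p.2))).submatrix fun p : r × b => (e p.1, p.2)
  convert h using 1
  ext p q
  simp [idTensor]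

theorem IsChannel.posSemidef [Fintype a] [Fintype b]
    {N : Matrix a a ℂ →ₗ[ℂ] Matrix b b ℂ} (hN : IsChannel N)
    {X : Matrix a a ℂ} (hX : X.PosSemidef) : (N X).PosSemidef :=
  (idTensor_posSemidef hN (hX.submatrix (Prod.snd : Unit × a → a))).submatrix
    fun i : b => ((), i)

theorem IsChannel.isState [Fintype a] [Fintype b]
    {N : Matrix a a ℂ →ₗ[ℂ] Matrix b b ℂ} (hN : IsChannel N)
    {X : Matrix a a ℂ} (hX : IsState X) : IsState (N X) :=
  ⟨hN.posSemidef hX.1, by rw [hN.tracePreserving, hX.2]⟩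

theorem useChannel_posSemidef [Fintype a] [Fintype b] [Fintype x] [Fintype y]
    {N : Matrix a a ℂ →ₗ[ℂ] Matrix b b ℂ} (hN : IsChannel N)
    {ρ : Matrix ((x × a) × y) ((x × a) × y) ℂ} (hρ : ρ.PosSemidef) :
    (useChannel N ρ).PosSemidef :=
  (idTensor_posSemidef hN (hρ.submatrix fun p : (x × y) × a =>
    ((p.1.1, p.2), p.1.2))).submatrix fun p : x × (b × y) => ((p.1, p.2.2), p.2.1)

theorem useChannel_sub (N : Matrix a a ℂ →ₗ[ℂ] Matrix b b ℂ)
    (ρ σ : Matrix ((x × a) × y) ((x × a) × y) ℂ) :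
    useChannel N (ρ - σ) = useChannel N ρ - useChannel N σ := by
  ext p q
  have := congrFun (congrFun (map_sub N
    (Matrix.of fun i j => ρ ((p.1, i), p.2.2) ((q.1, j), q.2.2))
    (Matrix.of fun i j => σ ((p.1, i), p.2.2) ((q.1, j), q.2.2))) p.2.1) q.2.1
  exact this

theorem useChannel_smul (N : Matrix a a ℂ →ₗ[ℂ] Matrix b b ℂ) (c : ℝ)
    (ρ : Matrix ((x × a) × y) ((x × a) × y) ℂ) :
    useChannel N (c • ρ) = c • useChannel N ρ := by
  ext p q
  have := congrFun (congrFun (LinearMap.map_smul_of_tower N c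
    (Matrix.of fun i j => ρ ((p.1, i), p.2.2) ((q.1, j), q.2.2))) p.2.1) q.2.1
  exact this

theorem useChannel_trace [Fintype a] [Fintype b] [Fintype x] [Fintype y]
    {N : Matrix a a ℂ →ₗ[ℂ] Matrix b b ℂ} (hN : IsChannel N)
    (ρ : Matrix ((x × a) × y) ((x × a) × y) ℂ) :
    (useChannel N ρ).trace = ρ.trace := by
  have h (u : x) (v : y) := hN.tracePreserving
    (Matrix.of fun i j => ρ ((u, i), v) ((u, j), v))
  simp only [Matrix.trace, Matrix.diag_apply, useChannel, Matrix.of_apply,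
    Fintype.sum_prod_type] at h ⊢
  refine Finset.sum_congr rfl fun u _ => ?_
  rw [Finset.sum_comm, Finset.sum_comm (s := (Finset.univ : Finset a))]
  exact Finset.sum_congr rfl fun v _ => h u v

/-! ### Separating B₁ from the other copies of B -/

section Splitting

variable [NeZero k]

/-- The labels of `B₁ ⋯ B_k` with prescribed entries at `B₁` and at the remaining systems. -/
def glue (u : b) (g : {j : Fin k // j ≠ 0} → b) : Fin k → b :=
  (Equiv.funSplitAt 0 b).symm (u, g)

theorem glue_zero (u : b) (g : {j : Fin k // j ≠ 0} → b) : glue u g 0 = u := by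
  simp [glue, Equiv.funSplitAt]

theorem comp_glue (f : a → b) (u : a) (g : {j : Fin k // j ≠ 0} → a) :
    f ∘ glue u g = glue (f u) (f ∘ g) := by
  funext j
  by_cases h : j = 0 <;> simp [glue, Equiv.funSplitAt, h]

theorem update_glue (u v : b) (g : {j : Fin k // j ≠ 0} → b) :
    Function.update (glue u g) 0 v = glue v g := by
  funext j
  by_cases h : j = 0
  · subst h; simp [glue_zero]
  · simp [glue, Equiv.funSplitAt, h]

theorem sum_glue [Fintype b] {M : Type*} [AddCommMonoid M] (F : (Fin k → b) → M) :
    ∑ f, F f = ∑ u, ∑ g, F (glue u g) := by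
  rw [← Equiv.sum_comp (Equiv.funSplitAt 0 b).symm, Fintype.sum_prod_type]
  rfl

/-- In this form rows and columns play symmetric roles, so the partial trace is visibly a sum of
compressions. -/
theorem traceOutRest_apply [Fintype b] [DecidableEq b]
    (ω : Matrix (a × (Fin k → b)) (a × (Fin k → b)) ℂ) (p q : a × b) :
    traceOutRest ω p q = ∑ g, ω (p.1, glue p.2 g) (q.1, glue q.2 g) := by
  simp only [traceOutRest, Matrix.of_apply, Finset.sum_filter]
  rw [sum_glue]
  simp only [glue_zero, update_glue, Finset.sum_ite_irrel, Finset.sum_const_zero,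
    Finset.sum_ite_eq', Finset.mem_univ, if_true]

theorem traceOutRest_posSemidef [Fintype a] [Fintype b] [DecidableEq b]
    {ω : Matrix (a × (Fin k → b)) (a × (Fin k → b)) ℂ} (hω : ω.PosSemidef) :
    (traceOutRest ω).PosSemidef := by
  have : traceOutRest ω = ∑ g : {j : Fin k // j ≠ 0} → b,
      ω.submatrix (fun p : a × b => (p.1, glue p.2 g)) (fun p => (p.1, glue p.2 g)) := by
    ext p q
    simp [traceOutRest_apply, Matrix.sum_apply]
  rw [this]
  exact Matrix.posSemidef_sum _ fun g _ => hω.submatrix _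

theorem traceOutRest_trace [Fintype a] [Fintype b] [DecidableEq b]
    (ω : Matrix (a × (Fin k → b)) (a × (Fin k → b)) ℂ) :
    (traceOutRest ω).trace = ω.trace := by
  simp only [Matrix.trace, Matrix.diag_apply, Fintype.sum_prod_type, traceOutRest_apply]
  exact Finset.sum_congr rfl fun u _ =>
    (sum_glue fun f => ω (u, f) (u, f)).symm

theorem traceOutRest_add [Fintype b] [DecidableEq b]
    (ω τ : Matrix (a × (Fin k → b)) (a × (Fin k → b)) ℂ) :
    traceOutRest (ω + τ) = traceOutRest ω + traceOutRest τ := by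
  ext p q
  simp [traceOutRest_apply, Finset.sum_add_distrib]

theorem traceOutRest_smul [Fintype b] [DecidableEq b] (c : ℝ)
    (ω : Matrix (a × (Fin k → b)) (a × (Fin k → b)) ℂ) :
    traceOutRest (c • ω) = c • traceOutRest ω := by
  ext p q
  simp [traceOutRest_apply, Finset.mul_sum]

theorem isExtendibleState_traceOutRest [Fintype a] [Fintype b] [DecidableEq b]
    {ω : Matrix (a × (Fin k → b)) (a × (Fin k → b)) ℂ} (hω : IsState ω)
    (hπ : ∀ π : Equiv.Perm (Fin k), permuteB π ω = ω) :
    IsExtendibleState k (traceOutRest ω) :=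
  ⟨⟨traceOutRest_posSemidef hω.1, by rw [traceOutRest_trace, hω.2]⟩, ω, hω, hπ, rfl⟩

/-! ### Domination by extendible states -/

/-- `ρ ≤ c σ` for some `k`-extendible state `σ`. -/
def IsDominated [Fintype a] [Fintype b] [DecidableEq b] (k : ℕ) [NeZero k] (c : ℝ)
    (ρ : Matrix (a × b) (a × b) ℂ) : Prop :=
  ∃ σ, IsExtendibleState k σ ∧ (c • σ - ρ).PosSemidef

/-- Covariance makes the image of an invariant extension invariant, the marginal condition
identifies what it extends, and positivity of `K` preserves the inequality. -/
theorem IsDominated.map {a' b' : Type*} [Fintype a] [Fintype b] [DecidableEq b]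
    [Fintype a'] [Fintype b'] [DecidableEq b'] {c : ℝ} {ρ : Matrix (a × b) (a × b) ℂ}
    (hρ : IsDominated k c ρ)
    {K : Matrix (a × b) (a × b) ℂ →ₗ[ℂ] Matrix (a' × b') (a' × b') ℂ}
    (hK : IsExtendibleChannel k K) : IsDominated k c (K ρ) := by
  obtain ⟨σ, ⟨-, ω, hω, hπ, rfl⟩, hle⟩ := hρ
  obtain ⟨hKc, M, hM, hcov, hmarg⟩ := hK
  refine ⟨traceOutRest (M ω), isExtendibleState_traceOutRest (hM.isState hω) fun π => ?_, ?_⟩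
  · rw [← hcov π ω hω, hπ]
  · rw [← hmarg ω hω, ← LinearMap.map_smul_of_tower, ← map_sub]
    exact hKc.posSemidef hle

theorem IsExtendibleState.isDominated [Fintype a] [Fintype b] [DecidableEq b]
    {ρ : Matrix (a × b) (a × b) ℂ} (hρ : IsExtendibleState k ρ) : IsDominated k 1 ρ :=
  ⟨ρ, hρ, by simpa using PosSemidef.zero⟩

theorem IsExtendibleState.mono [Fintype a] [Fintype b] [DecidableEq b] {c d : ℝ} (hcd : c ≤ d)
    {σ ρ : Matrix (a × b) (a × b) ℂ} (hσ : IsExtendibleState k σ)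
    (h : (c • σ - ρ).PosSemidef) : (d • σ - ρ).PosSemidef := by
  have := h.add (hσ.1.1.smul (sub_nonneg.2 hcd))
  convert this using 1
  rw [sub_smul]; abel

/-- A dominating extendible state can be chosen with an extension of full rank, at the cost of an
arbitrarily small increase of the constant. -/
theorem IsDominated.exists_posDef [Fintype a] [DecidableEq a] [Fintype b] [DecidableEq b]
    {c t : ℝ} (hc : 0 ≤ c) (ht : 1 < t)
    {ρ : Matrix (a × b) (a × b) ℂ} (hρ : IsDominated k c ρ) :
    ∃ ω : Matrix (a × (Fin k → b)) (a × (Fin k → b)) ℂ, IsState ω ∧ ω.PosDef ∧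
      (∀ π : Equiv.Perm (Fin k), permuteB π ω = ω) ∧
      ((c * t) • traceOutRest ω - ρ).PosSemidef := by
  obtain ⟨σ, ⟨-, ω, hω, hπ, rfl⟩, hle⟩ := hρ
  obtain ⟨D, hD⟩ : ∃ D : ℝ, D = (Fintype.card (a × (Fin k → b)) : ℝ) := ⟨_, rfl⟩
  have hne : Nonempty (a × (Fin k → b)) := by
    by_contra hempty
    rw [not_nonempty_iff] at hempty
    have := hω.2
    simp [Matrix.trace] at this
  have hDpos : 0 < D := by rw [hD]; exact_mod_cast Fintype.card_pos
  have ht0 : 0 < t := by linarith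
  have hs : 0 < (1 - t⁻¹) / D := div_pos (sub_pos.2 (inv_lt_one_of_one_lt₀ ht)) hDpos
  have hone : ((1 : Matrix (a × (Fin k → b)) (a × (Fin k → b)) ℂ)).PosDef := PosDef.one
  -- Mixing with the maximally mixed state, of weight 1 - t⁻¹. The factor `t` restores the full
  -- weight of `ω`, and the remaining term is positive.
  refine ⟨t⁻¹ • ω + ((1 - t⁻¹) / D) • 1, ⟨?_, ?_⟩, ?_, fun π => ?_, ?_⟩
  · exact (hω.1.smul (inv_nonneg.2 ht0.le)).add (hone.posSemidef.smul hs.le)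
  · rw [Matrix.trace_add, Matrix.trace_smul, Matrix.trace_smul, hω.2, Matrix.trace_one]
    have h1 : ((1 - t⁻¹) / D) * D = 1 - t⁻¹ := div_mul_cancel₀ _ hDpos.ne'
    have h2 : ((Fintype.card (a × (Fin k → b)) : ℕ) : ℂ) = ((D : ℝ) : ℂ) := by simp [hD]
    rw [h2, Complex.real_smul, Complex.real_smul, ← Complex.ofReal_mul, h1]
    push_cast; ring
  · exact PosDef.posSemidef_add (hω.1.smul (inv_nonneg.2 ht0.le)) (hone.smul hs)
  · have h1 : permuteB π (1 : Matrix (a × (Fin k → b)) (a × (Fin k → b)) ℂ) = 1 := by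
      ext p q
      have : (p.1, p.2 ∘ π) = (q.1, q.2 ∘ π) ↔ p = q := by
        rw [Prod.ext_iff, Prod.ext_iff]
        exact and_congr_right fun _ => ⟨fun h => π.surjective.injective_comp_right h,
          fun h => congrArg (· ∘ π) h⟩
      simp only [permuteB, Matrix.of_apply, Matrix.one_apply, this]
    ext p q
    have h2 := congrFun (congrFun (hπ π) p) q
    have h3 := congrFun (congrFun h1 p) q
    simp only [permuteB, Matrix.of_apply, Matrix.add_apply, Matrix.smul_apply] at h2 h3 ⊢
    rw [h2, h3]
  · rw [traceOutRest_add, traceOutRest_smul, traceOutRest_smul, smul_add, smul_smul,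
      mul_inv_cancel_right₀ ht0.ne', add_sub_right_comm]
    exact hle.add (((traceOutRest_posSemidef hone.posSemidef).smul hs.le).smul
      (mul_nonneg hc ht0.le))

end Splitting

/-! ### Link products of extensions -/

theorem linkProd_trace [Fintype r] [DecidableEq r] [Fintype x] [Fintype y] [Fintype z]
    {P : Matrix ((x × r) × y) ((x × r) × y) ℂ}
    (hP : ∀ i j, ∑ u, ∑ v, P ((u, i), v) ((u, j), v) = if i = j then 1 else 0)
    (X : Matrix (r × z) (r × z) ℂ) : (linkProd P X).trace = X.trace := by
  simp only [Matrix.trace, Matrix.diag_apply, Fintype.sum_prod_type, linkProd, Matrix.of_apply]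
  calc ∑ u, ∑ w, ∑ v, ∑ i, ∑ j, P ((u, i), v) ((u, j), v) * X (i, w) (j, w)
      = ∑ i, ∑ j, ∑ w, (∑ u, ∑ v, P ((u, i), v) ((u, j), v)) * X (i, w) (j, w) := by
        simp only [Finset.sum_mul]
        simp only [Finset.sum_comm (s := (Finset.univ : Finset y)) (t := (Finset.univ : Finset r)),
          Finset.sum_comm (s := (Finset.univ : Finset z)) (t := (Finset.univ : Finset r)),
          Finset.sum_comm (s := (Finset.univ : Finset x)) (t := (Finset.univ : Finset r)),
          Finset.sum_comm (s := (Finset.univ : Finset x)) (t := (Finset.univ : Finset z))]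
    _ = ∑ i, ∑ w, X (i, w) (i, w) := by
        refine Finset.sum_congr rfl fun i _ => ?_
        rw [Finset.sum_comm]
        simp [hP]

/-- Regrouping of `(B₁ ⋯ B_k)(C₁ ⋯ C_k)` as `(B₁C₁) ⋯ (B_kC_k)`. -/
def regroup (Ω : Matrix (x × ((Fin k → z) × (Fin k → y))) (x × ((Fin k → z) × (Fin k → y))) ℂ) :
    Matrix (x × (Fin k → z × y)) (x × (Fin k → z × y)) ℂ :=
  Ω.submatrix (fun p => (p.1, (Prod.fst ∘ p.2, Prod.snd ∘ p.2)))
    (fun p => (p.1, (Prod.fst ∘ p.2, Prod.snd ∘ p.2)))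

theorem sum_regroup {ι M : Type*} [Fintype ι] [DecidableEq ι] [Fintype y] [Fintype z]
    [AddCommMonoid M] (F : (ι → z) → (ι → y) → M) :
    ∑ f : ι → z × y, F (Prod.fst ∘ f) (Prod.snd ∘ f) = ∑ g, ∑ h, F g h := by
  rw [← Fintype.sum_prod_type', ← Equiv.sum_comp (Equiv.arrowProdEquivProdArrow ι
    (fun _ => z) (fun _ => y))]
  rfl

theorem regroup_trace [Fintype x] [Fintype y] [Fintype z]
    (Ω : Matrix (x × ((Fin k → z) × (Fin k → y))) (x × ((Fin k → z) × (Fin k → y))) ℂ) :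
    (regroup Ω).trace = Ω.trace := by
  simp only [Matrix.trace, Matrix.diag_apply]
  rw [Fintype.sum_prod_type, Fintype.sum_prod_type]
  refine Finset.sum_congr rfl fun u _ => ?_
  rw [Fintype.sum_prod_type]
  exact sum_regroup fun g h => Ω (u, (g, h)) (u, (g, h))

/-- The discarded labels of the two factors are independent, so the trace over them factorizes. -/
theorem traceOutRest_regroup_linkProd [NeZero k] [Fintype r] [Fintype y] [DecidableEq y]
    [Fintype z] [DecidableEq z]
    (P : Matrix ((x × r) × (Fin k → y)) ((x × r) × (Fin k → y)) ℂ)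
    (X : Matrix (r × (Fin k → z)) (r × (Fin k → z)) ℂ) :
    traceOutRest (regroup (linkProd P X)) = linkProd (traceOutRest P) (traceOutRest X) := by
  ext ⟨u, w, v⟩ ⟨u', w', v'⟩
  simp only [linkProd, traceOutRest_apply, Matrix.of_apply, regroup, Matrix.submatrix_apply,
    comp_glue]
  rw [sum_regroup fun g h => ∑ i, ∑ j, P ((u, i), glue v h) ((u', j), glue v' h) *
    X (i, glue w g) (j, glue w' g)]
  simp only [Finset.sum_mul_sum]
  rw [← Fintype.sum_prod_type', Finset.sum_comm]
  refine Finset.sum_congr rfl fun i _ => ?_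
  rw [Finset.sum_comm]
  refine Finset.sum_congr rfl fun j _ => ?_
  rw [Fintype.sum_prod_type, Finset.sum_comm]

theorem useChannel_eq_linkProd [Fintype r] (N : Matrix a a ℂ →ₗ[ℂ] Matrix b b ℂ)
    (ψ : r × a → ℂ) (P : Matrix ((x × r) × y) ((x × r) × y) ℂ)
    (σ : Matrix ((x × a) × y) ((x × a) × y) ℂ)
    (hσ : ∀ u v u' v' i j, σ ((u, i), v) ((u', j), v') =
      ∑ s, ∑ t, P ((u, s), v) ((u', t), v') * (ψ (s, i) * star (ψ (t, j)))) :
    useChannel N σ = linkProd P (idTensor N (vecMulVec ψ (star ψ))) := by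
  ext ⟨u, w, v⟩ ⟨u', w', v'⟩
  have h : (Matrix.of fun i j => σ ((u, i), v) ((u', j), v')) =
      ∑ s, ∑ t, P ((u, s), v) ((u', t), v') •
        Matrix.of fun i j => vecMulVec ψ (star ψ) (s, i) (t, j) := by
    ext i j
    simp [hσ, Matrix.sum_apply, vecMulVec_apply]
  simp only [useChannel, Matrix.of_apply, linkProd, idTensor]
  rw [h]
  simp only [map_sum, map_smul, Matrix.sum_apply, Matrix.smul_apply, smul_eq_mul]

theorem regroup_posSemidef [Fintype x] [Fintype y] [Fintype z]
    {Ω : Matrix (x × ((Fin k → z) × (Fin k → y))) (x × ((Fin k → z) × (Fin k → y))) ℂ}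
    (h : Ω.PosSemidef) : (regroup Ω).PosSemidef :=
  h.submatrix _

/-- The block of an operator on `X A Y` indexed by basis labels of `X Y`. -/
def block (ω : Matrix ((x × a) × y) ((x × a) × y) ℂ) (p q : x × y) : Matrix a a ℂ :=
  Matrix.of fun i j => ω ((p.1, i), p.2) ((q.1, j), q.2)

/-- Conjugation by an operator `L` on the system `A` of `X A Y`. -/
def conjMid [Fintype a] (L : Matrix a a ℂ) (ω : Matrix ((x × a) × y) ((x × a) × y) ℂ) :
    Matrix ((x × a) × y) ((x × a) × y) ℂ :=
  Matrix.of fun p q => (L * block ω (p.1.1, p.2) (q.1.1, q.2) * Lᴴ) p.1.2 q.1.2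

theorem block_conjMid [Fintype a] (L : Matrix a a ℂ)
    (ω : Matrix ((x × a) × y) ((x × a) × y) ℂ) (p q : x × y) :
    block (conjMid L ω) p q = L * block ω p q * Lᴴ := rfl

/-- Conjugation by `L` is the link product with the rank-one operator of the vectorization of `L`.
-/
theorem conjMid_posSemidef [Fintype a] [Fintype x] [Fintype y] (L : Matrix a a ℂ)
    {ω : Matrix ((x × a) × y) ((x × a) × y) ℂ} (hω : ω.PosSemidef) :
    (conjMid L ω).PosSemidef := by
  have h := (linkProd_posSemidef hω (posSemidef_vecMulVec_self_star
    fun p : a × a => L p.2 p.1)).submatrix fun p : (x × a) × y => (p.1.1, (p.1.2, p.2))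
  convert h using 1
  ext p q
  simp only [conjMid, linkProd, block, Matrix.of_apply, Matrix.submatrix_apply, vecMulVec_apply,
    Matrix.mul_apply, conjTranspose_apply, Pi.star_apply, Finset.sum_mul]
  rw [Finset.sum_comm]
  exact Finset.sum_congr rfl fun i _ => Finset.sum_congr rfl fun j _ => by ring

/-- An upper bound on the max-relative entropy of unextendibility of the outputs of `N` on pure
states is an upper bound on its increase under one use of `N`. -/
theorem IsDominated.amortized [NeZero k] [Fintype a] [DecidableEq a] [Fintype b] [DecidableEq b]
    [Fintype x] [DecidableEq x] [Fintype y] [DecidableEq y]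
    {N : Matrix a a ℂ →ₗ[ℂ] Matrix b b ℂ} (hN : IsChannel N) {c d t : ℝ}
    (hd : 0 ≤ d) (ht : 1 < t)
    (H : ∀ ψ : a × a → ℂ, ∑ x, ‖ψ x‖ ^ 2 = 1 →
      IsDominated k c (idTensor N (vecMulVec ψ (star ψ))))
    {ρ : Matrix ((x × a) × y) ((x × a) × y) ℂ} (hρ : IsDominated k d ρ) :
    IsDominated k (c * (d * t)) (useChannel N ρ) := by
  obtain ⟨ω, hω, hωpd, hωπ, hle⟩ := hρ.exists_posDef hd ht
  have hne : Nonempty ((x × a) × (Fin k → y)) := by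
    by_contra hempty
    rw [not_nonempty_iff] at hempty
    have := hω.2
    simp [Matrix.trace] at this
  have hne' : Nonempty (x × (Fin k → y)) := hne.map fun p => (p.1.1, p.2)
  -- The marginal of `ω` on A; full rank of `ω` makes it, and hence `G`, invertible.
  set w : Matrix a a ℂ := ∑ p, block ω p p with hw
  have hwpd : w.PosDef := Matrix.posDef_sum Finset.univ_nonempty fun p _ =>
    hωpd.submatrix (e := fun i => ((p.1, i), p.2)) fun i j h => by simpa using h
  obtain ⟨G, hG⟩ : ∃ G : Matrix a a ℂ, w = G * Gᴴ := by
    refine ⟨CFC.sqrt w, ?_⟩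
    have h0 : (0 : Matrix a a ℂ) ≤ w := nonneg_iff_posSemidef.2 hwpd.posSemidef
    rw [(nonneg_iff_posSemidef.1 (CFC.sqrt_nonneg w)).isHermitian.eq, CFC.sqrt_mul_sqrt_self w h0]
  have hGu : IsUnit G.det := by
    have := (Matrix.isUnit_iff_isUnit_det _).1 hwpd.isUnit
    rw [hG, Matrix.det_mul] at this
    exact isUnit_of_mul_isUnit_left this
  have hwtr : w.trace = 1 := by
    rw [← hω.2, hw, Matrix.trace_sum]
    simp only [Matrix.trace, Matrix.diag_apply, block, Matrix.of_apply, Fintype.sum_prod_type]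
    exact Finset.sum_congr rfl fun u _ => Finset.sum_comm
  set P := conjMid G⁻¹ ω with hP
  have hPpsd : P.PosSemidef := conjMid_posSemidef _ hω.1
  -- The map out of R with Choi operator `P` is trace preserving, since G⁻¹ w (G⁻¹)ᴴ = 1.
  have hPtr : ∀ i j, ∑ u, ∑ v, P ((u, i), v) ((u, j), v) = if i = j then 1 else 0 := by
    intro i j
    have h1 : ∑ p, block P p p = 1 := by
      simp only [hP, block_conjMid]
      rw [← Finset.sum_mul, ← Finset.mul_sum, ← hw, hG, ← Matrix.mul_assoc,
        Matrix.nonsing_inv_mul _ hGu, Matrix.one_mul, ← Matrix.conjTranspose_mul,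
        Matrix.nonsing_inv_mul _ hGu, Matrix.conjTranspose_one]
    have h2 := congrFun (congrFun h1 i) j
    rw [Matrix.sum_apply, Fintype.sum_prod_type, Matrix.one_apply] at h2
    exact h2
  have hPω : ∀ p q, block ω p q = G * block P p q * Gᴴ := by
    intro p q
    rw [hP, block_conjMid, ← Matrix.mul_assoc, ← Matrix.mul_assoc, Matrix.mul_nonsing_inv _ hGu,
      Matrix.one_mul, Matrix.mul_assoc, ← Matrix.conjTranspose_mul, Matrix.mul_nonsing_inv _ hGu,
      Matrix.conjTranspose_one, Matrix.mul_one]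
  have hPπ : ∀ π : Equiv.Perm (Fin k), permuteB π P = P := by
    intro π
    ext p q
    have h1 : block ω (p.1.1, p.2 ∘ π) (q.1.1, q.2 ∘ π) = block ω (p.1.1, p.2) (q.1.1, q.2) := by
      ext i j
      exact congrFun (congrFun (hωπ π) ((p.1.1, i), p.2)) ((q.1.1, j), q.2)
    simp only [permuteB, hP, conjMid, Matrix.of_apply, h1]
  -- The purification of `w` with first factor R: linking `P` with ψψ* gives back `ω`.
  let ψ : a × a → ℂ := fun p => G p.2 p.1
  have hψ : ∑ x, ‖ψ x‖ ^ 2 = 1 := by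
    have h1 : ((∑ x, ‖ψ x‖ ^ 2 : ℝ) : ℂ) = 1 := by
      rw [← hwtr, hG, Fintype.sum_prod_type, Finset.sum_comm]
      simp [Matrix.trace, Matrix.mul_apply, ψ, Complex.mul_conj, Complex.normSq_eq_norm_sq]
    exact_mod_cast h1
  obtain ⟨_, ⟨-, τ, hτ, hτπ, rfl⟩, hτle⟩ := H ψ hψ
  have hΩ : IsState (regroup (linkProd P τ)) :=
    ⟨regroup_posSemidef (linkProd_posSemidef hPpsd hτ.1),
      by rw [regroup_trace, linkProd_trace hPtr, hτ.2]⟩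
  refine ⟨_, isExtendibleState_traceOutRest hΩ fun π => ?_, ?_⟩
  · ext p q
    simp only [permuteB, regroup, linkProd, Matrix.of_apply, Matrix.submatrix_apply]
    refine Finset.sum_congr rfl fun i _ => Finset.sum_congr rfl fun j _ => ?_
    exact congrArg₂ (· * ·)
      (congrFun (congrFun (hPπ π) ((p.1, i), Prod.snd ∘ p.2)) ((q.1, j), Prod.snd ∘ q.2))
      (congrFun (congrFun (hτπ π) (i, Prod.fst ∘ p.2)) (j, Prod.fst ∘ q.2))
  · have h1 : useChannel N (traceOutRest ω) =
        linkProd (traceOutRest P) (idTensor N (vecMulVec ψ (star ψ))) := by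
      refine useChannel_eq_linkProd N ψ _ _ fun u v u' v' i j => ?_
      simp only [traceOutRest_apply, Finset.sum_mul]
      have h2 (g : {j : Fin k // j ≠ 0} → y) :
          ω ((u, i), glue v g) ((u', j), glue v' g) = ∑ s, ∑ t,
            P ((u, s), glue v g) ((u', t), glue v' g) * (ψ (s, i) * star (ψ (t, j))) := by
        have h3 := congrFun (congrFun (hPω (u, glue v g) (u', glue v' g)) i) j
        refine h3.trans ?_
        simp only [Matrix.mul_apply, conjTranspose_apply, Finset.sum_mul]
        rw [Finset.sum_comm]
        exact Finset.sum_congr rfl fun s _ => Finset.sum_congr rfl fun t _ => by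
          simp only [block, Matrix.of_apply, ψ]; ring
      rw [Finset.sum_congr rfl fun g _ => h2 g, Finset.sum_comm]
      exact Finset.sum_congr rfl fun s _ => Finset.sum_comm
    -- With σ' the new extendible state, the claim is the sum of d t (c σ' - N(Tr ω)) ≥ 0 and d t
    -- N(Tr ω) - N(ρ) ≥ 0.
    have h2 := (linkProd_posSemidef (traceOutRest_posSemidef hPpsd) hτle).smul
      (mul_nonneg hd (by linarith : (0 : ℝ) ≤ t))
    have h3 := useChannel_posSemidef hN hle
    rw [linkProd_sub, linkProd_smul, ← h1, ← traceOutRest_regroup_linkProd] at h2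
    rw [useChannel_sub, useChannel_smul] at h3
    convert h2.add h3 using 1
    rw [smul_sub, smul_smul, mul_comm (d * t) c]
    abel

/-! ### Overlap of extendible states with the maximally entangled state -/

theorem trace_mul_nonneg_of_posSemidef [Fintype a] {A B : Matrix a a ℂ} (hA : A.PosSemidef)
    (hB : B.PosSemidef) : 0 ≤ (A * B).trace := by
  classical
  have h0 : (0 : Matrix a a ℂ) ≤ B := nonneg_iff_posSemidef.2 hB
  have h1 := (nonneg_iff_posSemidef.1 (CFC.sqrt_nonneg B)).isHermitian.eq
  have h2 := (hA.conjTranspose_mul_mul_same (CFC.sqrt B)).trace_nonneg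
  rwa [h1, Matrix.trace_mul_comm, ← Matrix.mul_assoc, CFC.sqrt_mul_sqrt_self B h0,
    Matrix.trace_mul_comm] at h2

/-- The unnormalized maximally entangled operator `∑ |m⟩⟨n| ⊗ |m⟩⟨n|` on `A B_i`, as an
operator on `A B₁ ⋯ B_k`. -/
def entangler [DecidableEq b] (i : Fin k) :
    Matrix (b × (Fin k → b)) (b × (Fin k → b)) ℂ :=
  Matrix.of fun p q => if p.2 i = p.1 then
    if q.2 = Function.update p.2 i q.1 then 1 else 0 else 0

theorem entangler_mul_apply [Fintype b] [DecidableEq b] (i : Fin k)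
    (X : Matrix (b × (Fin k → b)) (b × (Fin k → b)) ℂ) (p q : b × (Fin k → b)) :
    (entangler (b := b) i * X) p q =
      if p.2 i = p.1 then ∑ m, X (m, Function.update p.2 i m) q else 0 := by
  rw [Matrix.mul_apply]
  split_ifs with h
  · simp [entangler, h, Fintype.sum_prod_type]
  · simp [entangler, h]

theorem entangler_isHermitian [DecidableEq b] (i : Fin k) :
    (entangler (b := b) i).IsHermitian := by
  ext p q
  have h (p q : b × (Fin k → b)) :
      (p.2 i = p.1 ∧ q.2 = Function.update p.2 i q.1) →
        (q.2 i = q.1 ∧ p.2 = Function.update q.2 i p.1) := by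
    rintro ⟨h1, h2⟩
    refine ⟨by simp [h2], ?_⟩
    rw [h2, Function.update_idem, ← h1, Function.update_eq_self]
  simp only [entangler, conjTranspose_apply, Matrix.of_apply, ← ite_and,
    apply_ite (star : ℂ → ℂ), star_one, star_zero]
  exact if_congr ⟨h q p, h p q⟩ rfl rfl

theorem entangler_mul_self [Fintype b] [DecidableEq b] (i : Fin k) :
    entangler (b := b) i * entangler i = (Fintype.card b : ℝ) • entangler i := by
  ext p q
  rw [entangler_mul_apply]
  simp [entangler]

/-- Diagrammatically a zigzag is straightened; no closed loop appears, hence no factor of the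
dimension, unlike in the square. -/
theorem entangler_mul_mul [Fintype b] [DecidableEq b] {i j : Fin k} (hij : i ≠ j) :
    entangler (b := b) i * entangler j * entangler i = entangler i := by
  ext p q
  rw [Matrix.mul_assoc, entangler_mul_apply]
  simp only [entangler_mul_apply, Function.update_of_ne hij.symm]
  have h1 (m : b) : Function.update (Function.update p.2 i m) j (p.2 j) =
      Function.update p.2 i m := by
    rw [Function.update_comm hij, Function.update_eq_self]
  simp [entangler, h1, hij]

/-- The Temperley–Lieb relations bound the sum of the entanglers. -/
theorem posSemidef_smul_one_sub_sum_entangler [Fintype b] [DecidableEq b] [Nonempty b]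
    (hk : 1 ≤ k) :
    (((Fintype.card b : ℝ) + k - 1) • (1 : Matrix (b × (Fin k → b)) (b × (Fin k → b)) ℂ) -
      ∑ i : Fin k, entangler i).PosSemidef := by
  set M : ℝ := (Fintype.card b : ℝ) with hM
  have hMpos : 0 < M := by rw [hM]; exact_mod_cast Fintype.card_pos
  have hc : 0 < M + k - 1 := by
    have : (1 : ℝ) ≤ k := by exact_mod_cast hk
    linarith
  set Q : Fin k → Matrix (b × (Fin k → b)) (b × (Fin k → b)) ℂ := entangler with hQ
  have hH (i) : (Q i)ᴴ = Q i := entangler_isHermitian i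
  have hsq (i) : Q i * Q i = M • Q i := entangler_mul_self i
  have htl {i j} (hij : i ≠ j) : Q i * Q j * Q i = Q i := entangler_mul_mul hij
  have hD {i j} (hij : i ≠ j) : (Q i + Q j - Q i * Q j - Q j * Q i).PosSemidef := by
    have h1 := (posSemidef_conjTranspose_mul_self (Q i - Q i * Q j)).smul (inv_nonneg.2 hMpos.le)
    -- The difference Q_i - Q_i Q_j is chosen so that the relations collapse its square to M times
    -- the wanted operator.
    have h2 : (Q i - Q i * Q j)ᴴ * (Q i - Q i * Q j) =
        M • (Q i + Q j - Q i * Q j - Q j * Q i) := by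
      have h3 : Q j * Q i * (Q i * Q j) = M • Q j := by
        rw [Matrix.mul_assoc, ← Matrix.mul_assoc (Q i), hsq, Matrix.smul_mul, Matrix.mul_smul,
          ← Matrix.mul_assoc, htl hij.symm]
      have h4 : Q i * (Q i * Q j) = M • (Q i * Q j) := by
        rw [← Matrix.mul_assoc, hsq, Matrix.smul_mul]
      have h5 : Q j * Q i * Q i = M • (Q j * Q i) := by
        rw [Matrix.mul_assoc, hsq, Matrix.mul_smul]
      rw [Matrix.conjTranspose_sub, Matrix.conjTranspose_mul, hH, hH, Matrix.sub_mul,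
        Matrix.mul_sub, Matrix.mul_sub, hsq, h3, h4, h5]
      simp only [smul_sub, smul_add]
      abel
    rwa [h2, smul_smul, inv_mul_cancel₀ hMpos.ne', one_smul] at h1
  set S := ∑ i, Q i with hS
  have hSH : Sᴴ = S := by rw [hS, Matrix.conjTranspose_sum]; simp only [hH]
  have hsum : ((M + k - 1) • S - S * S).PosSemidef := by
    have h1 : (∑ i, ∑ j, if i = j then 0 else
        (Q i + Q j - Q i * Q j - Q j * Q i)).PosSemidef := by
      refine Matrix.posSemidef_sum _ fun i _ => Matrix.posSemidef_sum _ fun j _ => ?_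
      split_ifs with h
      · exact PosSemidef.zero
      · exact hD h
    -- Over ordered pairs, the linear terms give 2(k - 1) S and the products give 2(S² - M S).
    -- Positivity of the sum thus says S² ≤ (M + k - 1) S.
    have h2 : (∑ i, ∑ j, if i = j then 0 else (Q i + Q j - Q i * Q j - Q j * Q i)) =
        (2 : ℝ) • ((M + k - 1) • S - S * S) := by
      have h3 (i j) : (if i = j then 0 else (Q i + Q j - Q i * Q j - Q j * Q i)) =
          Q i + Q j - Q i * Q j - Q j * Q i - if i = j then (2 - 2 * M) • Q i else 0 := by
        split_ifs with h
        · subst h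
          rw [hsq]
          module
        · simp
      simp only [h3, Finset.sum_sub_distrib, Finset.sum_add_distrib, Finset.sum_const,
        Finset.card_univ, Fintype.card_fin, Finset.sum_ite_eq, Finset.mem_univ, if_true,
        ← Finset.mul_sum, ← Finset.sum_mul, ← Finset.smul_sum, ← hS]
      rw [← Nat.cast_smul_eq_nsmul ℝ]
      module
    rw [h2] at h1
    have h4 := h1.smul (by norm_num : (0 : ℝ) ≤ 2⁻¹)
    rwa [smul_smul, inv_mul_cancel₀ (by norm_num : (2 : ℝ) ≠ 0), one_smul] at h4
  set c := M + k - 1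
  -- Uses c (c - S) = (c - S)² + (c S - S²), both summands being positive.
  have h1 := ((posSemidef_conjTranspose_mul_self (c • 1 - S)).add hsum).smul
    (inv_nonneg.2 hc.le)
  have h2 : (c • (1 : Matrix (b × (Fin k → b)) (b × (Fin k → b)) ℂ) - S)ᴴ * (c • 1 - S) +
      (c • S - S * S) = c • (c • 1 - S) := by
    rw [Matrix.conjTranspose_sub, Matrix.conjTranspose_smul, Matrix.conjTranspose_one, hSH]
    simp only [star_trivial, Matrix.sub_mul, Matrix.mul_sub, Matrix.smul_mul, Matrix.mul_smul,
      Matrix.one_mul, Matrix.mul_one]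
    module
  rwa [h2, smul_smul, inv_mul_cancel₀ hc.ne', one_smul] at h1

/-- Invariance under the transposition of 0 and `i` moves B_i to B₁, so the value does not depend on
`i`. -/
theorem trace_entangler_mul [NeZero k] [Fintype b] [DecidableEq b]
    {ω : Matrix (b × (Fin k → b)) (b × (Fin k → b)) ℂ}
    (hω : ∀ π : Equiv.Perm (Fin k), permuteB π ω = ω) (i : Fin k) :
    (entangler i * ω).trace = ∑ u, ∑ m, traceOutRest ω (m, m) (u, u) := by
  let e : (b × (Fin k → b)) ≃ (b × (Fin k → b)) :=
    Equiv.prodCongr (Equiv.refl b) (Equiv.arrowCongr (Equiv.swap 0 i) (Equiv.refl b))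
  have he (p : b × (Fin k → b)) : e p = (p.1, p.2 ∘ Equiv.swap 0 i) := by
    simp [e, Equiv.arrowCongr, Prod.map]
  have h1 : entangler (b := b) i = (entangler 0).submatrix e e := by
    ext p q
    have h2 : (q.2 = Function.update p.2 i q.1) ↔ (q.2 ∘ Equiv.swap 0 i =
        Function.update (p.2 ∘ Equiv.swap 0 i) 0 q.1) := by
      have h3 : Function.update (p.2 ∘ Equiv.swap 0 i) 0 q.1 =
          Function.update p.2 i q.1 ∘ Equiv.swap 0 i := by
        rw [Function.update_comp_equiv]
        simp
      rw [h3]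
      exact ⟨fun h => congrArg (· ∘ _) h,
        fun h => (Equiv.swap 0 i).surjective.injective_comp_right h⟩
    simp only [entangler, Matrix.of_apply, Matrix.submatrix_apply, he, ← h2,
      Function.comp_apply, Equiv.swap_apply_left]
  have h2 : ω = ω.submatrix e e := by
    ext p q
    rw [Matrix.submatrix_apply, he, he]
    exact (congrFun (congrFun (hω (Equiv.swap 0 i)) p) q).symm
  rw [h1]
  conv_lhs => rw [h2]
  rw [Matrix.submatrix_mul_equiv]
  simp only [Matrix.trace, Matrix.diag_apply, Matrix.submatrix_apply]
  refine (Equiv.sum_comp e fun p => (entangler (b := b) (0 : Fin k) * ω) p p).trans ?_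
  simp only [entangler_mul_apply, Fintype.sum_prod_type, traceOutRest_apply]
  refine Finset.sum_congr rfl fun u _ => ?_
  rw [sum_glue]
  simp only [glue_zero, update_glue, Finset.sum_ite_irrel, Finset.sum_const_zero,
    Finset.sum_ite_eq', Finset.mem_univ, if_true]
  rw [Finset.sum_comm]

/-- The overlap of a `k`-extendible state with the maximally entangled state. -/
theorem IsExtendibleState.trace_maxEntangled_mul_le [NeZero k] {M : ℕ} (hM : 1 ≤ M)
    {σ : Matrix (Fin M × Fin M) (Fin M × Fin M) ℂ} (hσ : IsExtendibleState k σ) :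
    (maxEntangled M * σ).trace.re ≤ 1 / M + 1 / k - 1 / (M * k) := by
  obtain ⟨-, ω, hω, hπ, rfl⟩ := hσ
  have : NeZero M := ⟨by omega⟩
  have hk : 1 ≤ k := Nat.one_le_iff_ne_zero.2 (NeZero.ne k)
  have hM0 : (0 : ℝ) < M := by exact_mod_cast hM
  have hk0 : (0 : ℝ) < k := by exact_mod_cast hk
  set T : ℂ := ∑ u, ∑ m, traceOutRest ω (m, m) (u, u) with hT
  have h1 : (maxEntangled M * traceOutRest ω).trace = (M : ℂ)⁻¹ * T := by
    simp only [Matrix.trace, Matrix.diag_apply, Matrix.mul_apply, maxEntangled, Matrix.of_apply,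
      Fintype.sum_prod_type, ite_and, ite_mul, zero_mul, Finset.sum_ite_irrel,
      Finset.sum_const_zero, Finset.sum_ite_eq, Finset.mem_univ, if_true,
      one_div, hT, Finset.mul_sum]
  have h2 := trace_mul_nonneg_of_posSemidef
    (posSemidef_smul_one_sub_sum_entangler (b := Fin M) hk) hω.1
  rw [Matrix.sub_mul, Matrix.trace_sub, Matrix.smul_mul, Matrix.one_mul, Matrix.trace_smul, hω.2,
    Finset.sum_mul, Matrix.trace_sum, Finset.sum_congr rfl fun i _ => trace_entangler_mul hπ i,
    ← hT, Finset.sum_const, Finset.card_univ, Fintype.card_fin, Fintype.card_fin] at h2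
  have h3 := (Complex.le_def.1 h2).1
  have h4 : ((M : ℂ)⁻¹ * T).re = (M : ℝ)⁻¹ * T.re := by
    rw [← Complex.ofReal_natCast, ← Complex.ofReal_inv, Complex.re_ofReal_mul]
  simp at h3
  rw [h1, h4]
  have h5 : (1 : ℝ) / M + 1 / k - 1 / (M * k) = (M : ℝ)⁻¹ * ((M + k - 1) / k) := by
    field_simp
    ring
  rw [h5]
  refine mul_le_mul_of_nonneg_left ?_ (inv_nonneg.2 hM0.le)
  rw [le_div_iff₀ hk0]
  linarith

/-! ### Fidelity with a pure state -/

/-- The fidelity with a pure state is the overlap. -/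
theorem fidelity_vecMulVec [Fintype a] [DecidableEq a] {ω : Matrix a a ℂ} (hω : ω.PosSemidef)
    {φ : a → ℂ} (hφ : star φ ⬝ᵥ φ = 1) :
    fidelity ω (vecMulVec φ (star φ)) = (vecMulVec φ (star φ) * ω).trace.re := by
  set Φ := vecMulVec φ (star φ) with hΦ
  have hpsd : Φ.PosSemidef := posSemidef_vecMulVec_self_star φ
  have hidem : Φ * Φ = Φ := by
    rw [hΦ, Matrix.vecMulVec_mul_vecMulVec, hφ, one_smul]
  have hsqrt : CFC.sqrt Φ = Φ := CFC.sqrt_unique hidem (nonneg_iff_posSemidef.2 hpsd)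
  have htr : Φ.trace = 1 := by
    rw [hΦ, Matrix.trace_vecMulVec, dotProduct_comm, hφ]
  have hc : 0 ≤ (Φ * ω).trace := trace_mul_nonneg_of_posSemidef hpsd hω
  obtain ⟨s, hs, hs'⟩ : ∃ s : ℝ, 0 ≤ s ∧ (Φ * ω).trace = s :=
    ⟨(Φ * ω).trace.re, (Complex.le_def.1 hc).1, Complex.ext rfl (Complex.le_def.1 hc).2.symm⟩
  -- Compression by a rank-one projection is scalar, so the square root in the trace norm is
  -- explicit.
  have hcomp : Φ * ω * Φ = s • Φ := by
    have h1 : (Φ * ω).trace = star φ ᵥ* ω ⬝ᵥ φ := by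
      rw [hΦ, Matrix.vecMulVec_mul, Matrix.trace_vecMulVec, dotProduct_comm]
    have h2 : Φ * ω * Φ = (star φ ᵥ* ω ⬝ᵥ φ) • Φ := by
      rw [hΦ, Matrix.vecMulVec_mul, Matrix.vecMulVec_mul_vecMulVec, Matrix.vecMulVec_smul]
    rw [h2, ← h1, hs']
    rfl
  have hω0 : (0 : Matrix a a ℂ) ≤ ω := nonneg_iff_posSemidef.2 hω
  have hωH := (nonneg_iff_posSemidef.1 (CFC.sqrt_nonneg ω)).isHermitian.eq
  have hX : (CFC.sqrt ω * Φ)ᴴ * (CFC.sqrt ω * Φ) = s • Φ := by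
    rw [Matrix.conjTranspose_mul, hωH, hpsd.isHermitian.eq, ← hcomp, ← Matrix.mul_assoc,
      Matrix.mul_assoc Φ, CFC.sqrt_mul_sqrt_self ω hω0]
  have hroot : CFC.sqrt (s • Φ) = √s • Φ := by
    refine CFC.sqrt_unique ?_ (nonneg_iff_posSemidef.2 (hpsd.smul (Real.sqrt_nonneg s)))
    rw [Matrix.smul_mul, Matrix.mul_smul, hidem, smul_smul, Real.mul_self_sqrt hs]
  rw [fidelity, traceNorm, hsqrt, hX, hroot, Matrix.trace_smul, htr, hs']
  simp [Real.sq_sqrt hs]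

theorem exists_maxEntangled_eq_vecMulVec {M : ℕ} (hM : 1 ≤ M) :
    ∃ φ : Fin M × Fin M → ℂ, star φ ⬝ᵥ φ = 1 ∧ maxEntangled M = vecMulVec φ (star φ) := by
  have hM0 : (0 : ℝ) < M := by exact_mod_cast hM
  have hsq : (((√M)⁻¹ : ℝ) : ℂ) * (((√M)⁻¹ : ℝ) : ℂ) = (M : ℂ)⁻¹ := by
    rw [← Complex.ofReal_mul, ← mul_inv, Real.mul_self_sqrt hM0.le]
    simp
  refine ⟨fun p => if p.1 = p.2 then (((√M)⁻¹ : ℝ) : ℂ) else 0, ?_, ?_⟩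
  · simp only [dotProduct, Pi.star_apply, apply_ite (star : ℂ → ℂ), star_zero, ite_mul,
      mul_ite, zero_mul, mul_zero, RCLike.star_def, Complex.conj_ofReal, hsq,
      Fintype.sum_prod_type]
    have : (M : ℂ) ≠ 0 := by exact_mod_cast hM0.ne'
    simp [this]
  · ext p q
    simp only [maxEntangled, Matrix.of_apply, vecMulVec_apply, Pi.star_apply,
      apply_ite (star : ℂ → ℂ), star_zero, ite_mul, mul_ite, zero_mul, mul_zero, RCLike.star_def,
      Complex.conj_ofReal, hsq, ite_and, one_div]
    split_ifs <;> rfl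

theorem maxEntangled_posSemidef {M : ℕ} (hM : 1 ≤ M) : (maxEntangled M).PosSemidef := by
  obtain ⟨φ, -, h⟩ := exists_maxEntangled_eq_vecMulVec hM
  rw [h]
  exact posSemidef_vecMulVec_self_star φ

theorem fidelity_maxEntangled {M : ℕ} (hM : 1 ≤ M)
    {ω : Matrix (Fin M × Fin M) (Fin M × Fin M) ℂ} (hω : ω.PosSemidef) :
    fidelity ω (maxEntangled M) = (maxEntangled M * ω).trace.re := by
  obtain ⟨φ, hφ, h⟩ := exists_maxEntangled_eq_vecMulVec hM
  rw [h]
  exact fidelity_vecMulVec hω hφ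

/-! ### From entropies to domination -/

theorem isExtendibleState_one [NeZero k] :
    IsExtendibleState k (1 : Matrix (Unit × Unit) (Unit × Unit) ℂ) := by
  have h1 : IsState (1 : Matrix (Unit × (Fin k → Unit)) (Unit × (Fin k → Unit)) ℂ) :=
    ⟨PosSemidef.one, by simp⟩
  have h2 : traceOutRest (1 : Matrix (Unit × (Fin k → Unit)) (Unit × (Fin k → Unit)) ℂ) = 1 := by
    ext p q
    rw [traceOutRest_apply, Subsingleton.elim q p]
    simp
  rw [← h2]
  refine isExtendibleState_traceOutRest h1 fun π => ?_
  ext p q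
  exact congrArg₂ (1 : Matrix (Unit × (Fin k → Unit)) (Unit × (Fin k → Unit)) ℂ)
    (Subsingleton.elim _ _) (Subsingleton.elim _ _)

/-- Strict inequality yields a witness without attainment of the infimum. -/
theorem isDominated_of_eMaxState_lt [NeZero k] [Fintype a] [Fintype b] [DecidableEq b]
    {ρ : Matrix (a × b) (a × b) ℂ} {l : ℝ}
    (h : eMaxState k ρ < (l : EReal)) : IsDominated k ((2 : ℝ) ^ l) ρ := by
  simp only [eMaxState, dMax, iInf_lt_iff] at h
  obtain ⟨σ, hσ, m, hle, hml⟩ := h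
  exact ⟨σ, hσ, hσ.mono
    (Real.rpow_le_rpow_of_exponent_le one_le_two (EReal.coe_lt_coe_iff.1 hml).le) hle⟩

theorem eMaxState_nonneg [NeZero k] [Fintype a] [Fintype b] [DecidableEq b]
    {ρ : Matrix (a × b) (a × b) ℂ} (hρ : ρ.trace = 1) :
    0 ≤ eMaxState k ρ := by
  refine le_iInf₂ fun σ hσ => le_iInf₂ fun l hl => ?_
  have h1 := hl.trace_nonneg
  rw [Matrix.trace_sub, Matrix.trace_smul, hσ.1.2, hρ] at h1
  have h2 := (Complex.le_def.1 h1).1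
  simp only [Complex.zero_re, Complex.sub_re, Complex.real_smul, mul_one, Complex.ofReal_re,
    Complex.one_re] at h2
  have h3 : (2 : ℝ) ^ (0 : ℝ) ≤ 2 ^ l := by rw [Real.rpow_zero]; linarith
  exact_mod_cast (Real.rpow_le_rpow_left_iff one_lt_two).1 h3

/-! ### Accumulating the cost along a protocol -/

section Protocol

variable [NeZero k] [Fintype a] [DecidableEq a] [Fintype b] [DecidableEq b]
  {N : Matrix a a ℂ →ₗ[ℂ] Matrix b b ℂ}

theorem eMaxChannel_nonneg [Nonempty a] (hN : IsChannel N) : 0 ≤ eMaxChannel k N := by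
  obtain ⟨i⟩ := ‹Nonempty a›
  have h : ∑ x, ‖(Pi.single (i, i) 1 : a × a → ℂ) x‖ ^ 2 = 1 := by
    rw [Finset.sum_eq_single (i, i)] <;> simp +contextual
  refine le_trans ?_ (le_iSup₂ (f := fun (ψ : a × a → ℂ) (_ : ∑ x, ‖ψ x‖ ^ 2 = 1) =>
    eMaxState k (idTensor N (vecMulVec ψ (star ψ)))) _ h)
  refine eMaxState_nonneg ?_
  have h1 (X : Matrix (a × a) (a × a) ℂ) : (idTensor N X).trace = X.trace := by
    simp only [Matrix.trace, Matrix.diag_apply, Fintype.sum_prod_type]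
    exact Finset.sum_congr rfl fun u _ =>
      hN.tracePreserving (Matrix.of fun i j => X (u, i) (u, j))
  rw [h1, Matrix.trace_vecMulVec]
  rw [Pi.star_single, star_one, dotProduct_single_one, Pi.single_eq_same]

theorem ProtocolPrefix.stateBefore_isState (hN : IsChannel N) {n dA dB : ℕ}
    (P : ProtocolPrefix k a b n dA dB) : IsState (P.stateBefore N) := by
  induction P with
  | init K hK => exact hK.1.isState ⟨PosSemidef.one, by simp⟩
  | step P K hK ih =>
    exact hK.1.isState ⟨useChannel_posSemidef hN ih.1, by rw [useChannel_trace hN, ih.2]⟩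

theorem AssistedProtocol.finalState_isState (hN : IsChannel N) {n M : ℕ}
    (P : AssistedProtocol k n M a b) : IsState (P.finalState N) :=
  P.final_extendible.1.isState ⟨useChannel_posSemidef hN (P.pre.stateBefore_isState hN).1,
    by rw [useChannel_trace hN, (P.pre.stateBefore_isState hN).2]⟩

/-- Unit trace excludes an empty index type, for which the supremum in `eMaxChannel` would be ⊥. -/
theorem AssistedProtocol.nonempty_input (hN : IsChannel N) {n M : ℕ}
    (P : AssistedProtocol k n M a b) : Nonempty a := by
  by_contra hempty
  rw [not_nonempty_iff] at hempty
  have := (P.pre.stateBefore_isState hN).2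
  simp [Matrix.trace] at this

/-- One use of the channel costs at most `l` whenever `l` exceeds its unextendibility. -/
theorem IsDominated.amortized_of_lt (hN : IsChannel N) [Fintype x] [DecidableEq x] [Fintype y]
    [DecidableEq y] {l d : ℝ} (hl : eMaxChannel k N < (l : EReal)) (hd : 0 ≤ d)
    {ρ : Matrix ((x × a) × y) ((x × a) × y) ℂ} (hρ : IsDominated k d ρ) :
    IsDominated k (2 ^ l * d) (useChannel N ρ) := by
  -- The gap between `m` and `l` pays for the factor t = 2^(l - m) > 1 of the full-rank
  -- perturbation.
  obtain ⟨m, hm, hml⟩ := EReal.lt_iff_exists_real_btwn.1 hl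
  rw [EReal.coe_lt_coe_iff] at hml
  have h := hρ.amortized hN (c := 2 ^ m) (t := 2 ^ (l - m)) hd
    (Real.one_lt_rpow one_lt_two (sub_pos.2 hml)) fun ψ hψ =>
      isDominated_of_eMaxState_lt (lt_of_le_of_lt
        (le_iSup₂ (f := fun (ψ : a × a → ℂ) (_ : ∑ x, ‖ψ x‖ ^ 2 = 1) =>
          eMaxState k (idTensor N (vecMulVec ψ (star ψ)))) ψ hψ) hm)
  convert h using 1
  rw [mul_comm d, ← mul_assoc, ← Real.rpow_add two_pos, add_sub_cancel]

theorem ProtocolPrefix.useChannel_isDominated (hN : IsChannel N) {l : ℝ}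
    (hl : eMaxChannel k N < (l : EReal)) {n dA dB : ℕ} (P : ProtocolPrefix k a b n dA dB) :
    IsDominated k (((2 : ℝ) ^ l) ^ n) (useChannel N (P.stateBefore N)) := by
  induction P with
  | init K hK =>
    rw [pow_one, ← mul_one ((2 : ℝ) ^ l)]
    exact (isExtendibleState_one.isDominated.map hK).amortized_of_lt hN hl zero_le_one
  | step P K hK ih =>
    rw [pow_succ']
    exact (ih.map hK).amortized_of_lt hN hl (by positivity)

theorem AssistedProtocol.one_sub_le (hN : IsChannel N) {n M : ℕ} (hM : 1 ≤ M)
    (P : AssistedProtocol k n M a b) {ε : ℝ} (hP : P.Achieves N ε) {l : ℝ}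
    (hl : eMaxChannel k N < (l : EReal)) :
    1 - ε ≤ ((2 : ℝ) ^ l) ^ n * (1 / M + 1 / k - 1 / (M * k)) := by
  obtain ⟨σ, hσ, hle⟩ := (P.pre.useChannel_isDominated hN hl).map P.final_extendible
  have h1 := trace_mul_nonneg_of_posSemidef (maxEntangled_posSemidef hM) hle
  rw [Matrix.mul_sub, Matrix.trace_sub, Matrix.mul_smul, Matrix.trace_smul] at h1
  have h2 := (Complex.le_def.1 h1).1
  rw [Complex.zero_re, Complex.sub_re, Complex.smul_re, smul_eq_mul] at h2
  have h3 := mul_le_mul_of_nonneg_left (hσ.trace_maxEntangled_mul_le hM)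
    (by positivity : (0 : ℝ) ≤ ((2 : ℝ) ^ l) ^ n)
  have h4 : 1 - ε ≤ _ := hP
  rw [fidelity_maxEntangled hM (P.finalState_isState hN).1] at h4
  exact h4.trans ((sub_nonneg.1 h2).trans h3)

end Protocol

end

end KUnext

/-! ### The converse bound -/

theorem theorem3 {a b : Type*} [Fintype a] [DecidableEq a] [Fintype b] [DecidableEq b]
    (k : ℕ) [NeZero k] (hk : 2 ≤ k)
    (n M : ℕ) (hn : 1 ≤ n) (hM : 1 ≤ M) (ε : ℝ) (hε₀ : 0 ≤ ε) (hε₁ : ε ≤ 1)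
    (N : Matrix a a ℂ →ₗ[ℂ] Matrix b b ℂ) (hN : KUnext.IsChannel N)
    (P : KUnext.AssistedProtocol k n M a b) (hP : P.Achieves N ε) :
    ((-Real.logb 2 (1 / (M : ℝ) + 1 / (k : ℝ) - 1 / ((M : ℝ) * (k : ℝ))) : ℝ) : EReal) ≤
      (n : EReal) * KUnext.eMaxChannel k N + KUnext.log2Inv (1 - ε) := by
  have hne := P.nonempty_input hN
  have hE := KUnext.eMaxChannel_nonneg (k := k) hN
  have hn0 : (0 : EReal) < n := by exact_mod_cast hn
  have hnE : 0 ≤ (n : EReal) * KUnext.eMaxChannel k N := mul_nonneg hn0.le hE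
  set g : ℝ := 1 / (M : ℝ) + 1 / (k : ℝ) - 1 / ((M : ℝ) * (k : ℝ)) with hg
  rcases hε₁.eq_or_lt with rfl | hε
  · simp only [KUnext.log2Inv, sub_self, lt_irrefl, if_false]
    -- In `EReal`, ⊥ + ⊤ = ⊥, so nonnegativity of the first term is needed here.
    rw [EReal.add_top_of_ne_bot (fun h => by simp [h] at hnE)]
    exact le_top
  have hε' : 0 < 1 - ε := sub_pos.2 hε
  have hbound := fun l hl => P.one_sub_le hN hM hP (l := l) hl
  rw [KUnext.log2Inv, if_pos hε']
  generalize KUnext.eMaxChannel k N = E at hE hbound hnE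
  induction E with
  | bot => simp at hE
  | top =>
    rw [EReal.mul_top_of_pos hn0, EReal.top_add_coe]
    exact le_top
  | coe e =>
    have hnn : (n : EReal) = ((n : ℝ) : EReal) := rfl
    rw [hnn, ← EReal.coe_mul, ← EReal.coe_add, EReal.coe_le_coe_iff]
    have hgpos : 0 < g := by
      have hM0 : (1 : ℝ) ≤ M := by exact_mod_cast hM
      have hk0 : (2 : ℝ) ≤ k := by exact_mod_cast hk
      have : g = (M + k - 1) / (M * k) := by rw [hg]; field_simp; ring
      rw [this]
      exact div_pos (by linarith) (by positivity)
    have hkey : ∀ δ : ℝ, 0 < δ →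
        -Real.logb 2 g ≤ n * e + Real.logb 2 (1 / (1 - ε)) + n * δ := by
      intro δ hδ
      have h1 := hbound (e + δ) (EReal.coe_lt_coe_iff.2 (by linarith))
      have h2 := Real.logb_le_logb_of_le one_lt_two hε' h1
      rw [Real.logb_mul (by positivity) hgpos.ne', Real.logb_pow,
        Real.logb_rpow two_pos (by norm_num)] at h2
      rw [one_div, Real.logb_inv]
      linarith
    refine le_of_forall_pos_le_add fun δ hδ => ?_
    have hn1 : (0 : ℝ) < n := by exact_mod_cast hn
    -- Each of the n uses contributes one slack, so the choice δ/n makes the total δ.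
    have := hkey (δ / n) (div_pos hδ hn1)
    rwa [mul_div_cancel₀ _ hn1.ne'] at this
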